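/- Let $k$ be a field, $n,s,l\ge 0$ integers, $k(L)=k(a_0,\dots,a_n)$, let $A$ be a commutative $k$-algebra and $A_L=A\otimes_k k(L)$. Let $\mathbb G$ be the Grassmannian over $k$ of codimension $l$ subspaces of $k^s$: for a $k$-algebra $R$, a $k$-morphism $\operatorname{Spec}R\to\mathbb G$ is a submodule $W\subset R^s$ such that $R^s/W$ is locally free of rank $l$. If $R^s/W$ is free with basis $F$, the determinants $P_i=\det_F(\bar e_{i_1},\dots,\bar e_{i_l})$, $i=(i_1,\dots,i_l)\in\{1,\dots,s\}^l$, are called Plücker coordinates of this morphism (they depend on $F$ only through a common unit). For a $k$-morphism $f:X\to\mathbb G$, a family $(p_i(j))_{i\in\{1,\dots,s\}^l,\ j\in J}$ of global sections of $\mathcal O_X$ is a superabundant family of Plücker coordinates for $f$ if for every $x\in X$ there is $j_x\in J$ such that the germs at $x$ of $(p_i(j_x))_i$ are Plücker coordinates of the localized morphism $\operatorname{Spec}\mathcal O_{X,x}\to\mathbb G$, and for every $j\in J$ there is $b_j\in\mathcal O_{X,x}$ with $p_i(j)=b_j\,p_i(j_x)$ in $\mathcal O_{X,x}$ for all $i$.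 A morphism $X\to Y$ is called schematically dominant if it factors through no closed subscheme of $Y$ other than $Y$. Let $e:U_{A,L}\hookrightarrow\operatorname{Spec}A_L$ be a schematically dominant open embedding such that the first projection $pr_1:U_{A,L}\to\operatorname{Spec}A$ is schematically dominant, and such that every closed point of $\operatorname{Spec}A$ is the image under $pr_1$ of a point of $U_{A,L}$. Let $h_{A,L}:U_{A,L}\to\mathbb G$ be a $k$-morphism, and let $p_i(j)\in A[a_0,\dots,a_n]$ ($i\in\{1,\dots,s\}^l$, $j\in J$, for an arbitrary set $J$) be such that the restrictions $e^*(p_i(j))\in\mathcal O_{U_{A,L}}(U_{A,L})$ form a superabundant family of Plücker coordinates for $h_{A,L}$. For $\alpha\in\mathbb N^{n+1}$ let $p_i^\alpha(j)\in A$ be the coefficient of $a_0^{\alpha_0}\cdots a_n^{\alpha_n}$ in $p_i(j)$. Then the following are equivalent: 1. there is a $k$-morphism $h:\operatorname{Spec}A\to\mathbb G$ with $h_{A,L}=h\circ pr_1$; 2. for all $i_1,i_2,j_1,j_2,\alpha_1,\alpha_2$ one has $p_{i_1}^{\alpha_1}(j_1)\,p_{i_2}^{\alpha_2}(j_2)=p_{i_2}^{\alpha_1}(j_1)\,p_{i_1}^{\alpha_2}(j_2)$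 in $A$. -/

import Mathlib

open CategoryTheory AlgebraicGeometry Opposite
open scoped TensorProduct

universe u

namespace GrassmannianFactorisation

section Grassmannian

variable (k : Type u) [Field k]

/-- `Spec R` as a scheme over `Spec k`, for a commutative `k`-algebra `R`. -/
noncomputable abbrev specOver (R : Type u) [CommRing R] [Algebra k R] :
    Over (Spec (CommRingCat.of k)) :=
  (algSpec (CommRingCat.of k)).obj (op (CommAlgCat.of k R))

/-- The functor of points of a `k`-scheme `X`, restricted to affine `k`-schemes:
it sends a commutative `k`-algebra `R` to the set of `k`-morphisms `Spec R ⟶ X`. -/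
noncomputable abbrev points (X : Over (Spec (CommRingCat.of k))) :
    CommAlgCat.{u} k ⥤ Type u :=
  (algSpec (CommRingCat.of k)).rightOp ⋙ yoneda.obj X

/-- The Grassmannian of `k ^ s`, classifying quotients of rank `l` (that is, subspaces of
codimension `l`), given by its functor of points: it sends a commutative `k`-algebra `R` to the set
of submodules `W` of `R ⊗ k ^ s` whose quotient is locally free of rank `l`, and a homomorphism
`R → R'` acts by base change. -/
noncomputable abbrev grassmannian (s l : ℕ) : CommAlgCat.{u} k ⥤ Type u :=
  Module.Grassmannian.functor (R := k) (M := Fin s → k) l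

variable {k}

/-- A `k`-morphism from a `k`-scheme `X` to the Grassmannian: a rule assigning to every `k`-morphism
`Spec R ⟶ X` an `R`-point of the Grassmannian, compatibly with base change. As schemes
embed fully faithfully into functors on commutative algebras, these are the morphisms of
`k`-schemes from `X` to the scheme representing `grassmannian k s l`. -/
abbrev GrassmannianMorphism (X : Over (Spec (CommRingCat.of k))) (s l : ℕ) : Type (u + 1) :=
  points k X ⟶ grassmannian k s l

/-- The composition of a morphism `g : Y ⟶ X` with a morphism `f` from `X` to a Grassmannian. -/
noncomputable def GrassmannianMorphism.precomp {X Y : Over (Spec (CommRingCat.of k))} {s l : ℕ}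
    (f : GrassmannianMorphism X s l) (g : Y ⟶ X) : GrassmannianMorphism Y s l :=
  Functor.whiskerLeft _ (yoneda.map g) ≫ f

/-- The local ring of a `k`-scheme at a point, as a `k`-algebra. -/
noncomputable def stalkAlgebra (X : Over (Spec (CommRingCat.of k))) (x : X.left) :
    CommAlgCat.{u} k :=
  letI : Algebra k (X.left.presheaf.stalk x) :=
    (Spec.preimage (X.left.fromSpecStalk x ≫ X.hom)).hom.toAlgebra
  CommAlgCat.of k (X.left.presheaf.stalk x)

/-- The canonical morphism `Spec 𝒪_{X,x} ⟶ X`, as a morphism over `Spec k`. -/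
noncomputable def stalkPoint (X : Over (Spec (CommRingCat.of k))) (x : X.left) :
    (points k X).obj (stalkAlgebra X x) :=
  Over.homMk (X.left.fromSpecStalk x) (Spec.map_preimage _).symm

/-- The localization at `x` of a morphism from `X` to a Grassmannian, namely its restriction to
`Spec 𝒪_{X,x}`, seen as an `𝒪_{X,x}`-point of the Grassmannian. -/
noncomputable def GrassmannianMorphism.localize {X : Over (Spec (CommRingCat.of k))} {s l : ℕ}
    (f : GrassmannianMorphism X s l) (x : X.left) :
    Module.Grassmannian (stalkAlgebra X x) (stalkAlgebra X x ⊗[k] (Fin s → k)) l :=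
  f.app (stalkAlgebra X x) (stalkPoint X x)

/-- The germ at `x` of a global section, as an element of `𝒪_{X,x}`. -/
noncomputable def germAt (X : Over (Spec (CommRingCat.of k))) (x : X.left)
    (t : Γ(X.left, ⊤)) : stalkAlgebra X x :=
  (X.left.presheaf.germ ⊤ x trivial).hom t

/-- `P` is a family of Plücker coordinates for an `R`-point `W ⊆ R ^ s` of the Grassmannian:
for some basis `F` of `R ^ s / W` with `l` elements and all indices `i₁, …, i_l`, the element
`P (i₁, …, i_l)` is the determinant, with respect to `F`, of the classes of the canonical basis
vectors `e_{i₁}, …, e_{i_l}`. -/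
def IsPluckerCoordinates {R : Type u} [CommRing R] [Algebra k R] {s l : ℕ}
    (W : Module.Grassmannian R (R ⊗[k] (Fin s → k)) l) (P : (Fin l → Fin s) → R) : Prop :=
  ∃ F : Module.Basis (Fin l) R ((R ⊗[k] (Fin s → k)) ⧸ W.toSubmodule),
    ∀ i : Fin l → Fin s,
      P i = F.det fun m => W.toSubmodule.mkQ (1 ⊗ₜ[k] (Pi.single (i m) 1 : Fin s → k))

/-- A superabundant family of Plücker coordinates for a morphism `f` from `X` to a Grassmannian:
a family of global sections `p j i` of `𝒪_X` such that, at every point `x`, there is an index `j₀`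
for which the germs of the `p j₀ i` are Plücker coordinates of the localization of `f` at `x`,
while for every `j` the germs of the `p j i` are a common multiple of the germs of the `p j₀ i`. -/
def IsSuperabundant {X : Over (Spec (CommRingCat.of k))} {s l : ℕ}
    (f : GrassmannianMorphism X s l) {J : Type*} (p : J → (Fin l → Fin s) → Γ(X.left, ⊤)) : Prop :=
  ∀ x : X.left, ∃ j₀ : J,
    IsPluckerCoordinates (f.localize x) (fun i => germAt X x (p j₀ i)) ∧
    ∀ j : J, ∃ b : stalkAlgebra X x, ∀ i, germAt X x (p j i) = b * germAt X x (p j₀ i)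

end Grassmannian

section GenericLinearForm

variable (k : Type u) [Field k] (A : Type u) [CommRing A] [Algebra k A] (n : ℕ)

/-- The field `k(L) = k(a₀, …, a_n)` of rational functions. -/
abbrev RatFun : Type u := FractionRing (MvPolynomial (Fin (n + 1)) k)

/-- The `k`-algebra `A_L = A ⊗ k(L)`. -/
abbrev GenericExtension : Type u := A ⊗[k] RatFun k n

/-- The canonical map `A[a₀, …, a_n] = A ⊗ k[a₀, …, a_n] → A ⊗ k(a₀, …, a_n) = A_L`. -/
noncomputable def ofPolynomial :
    MvPolynomial (Fin (n + 1)) A →ₐ[A] GenericExtension k A n :=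
  MvPolynomial.aeval fun m => 1 ⊗ₜ[k] algebraMap (MvPolynomial (Fin (n + 1)) k) (RatFun k n)
    (MvPolynomial.X m)

/-- The first projection `Spec A_L ⟶ Spec A`. -/
noncomputable def firstProjection :
    specOver k (GenericExtension k A n) ⟶ specOver k A :=
  (algSpec (CommRingCat.of k)).map (CommAlgCat.ofHom
    (Algebra.TensorProduct.includeLeft : A →ₐ[k] GenericExtension k A n)).op

variable {k A n}

/-- The pullback `e^* : A_L → 𝒪_U(U)` of functions along a `k`-morphism `e : U ⟶ Spec A_L`. -/
noncomputable def pullbackFunction {U : Over (Spec (CommRingCat.of k))}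
    (e : U ⟶ specOver k (GenericExtension k A n)) (t : GenericExtension k A n) : Γ(U.left, ⊤) :=
  e.left.appTop.hom ((Scheme.ΓSpecIso (CommRingCat.of (GenericExtension k A n))).inv.hom t)

end GenericLinearForm

end GrassmannianFactorisation

/-! An `A`-point of the Grassmannian has projective quotient, so it is the kernel of an idempotent
`s × s` matrix over `A`. For `x` in `U`, let `M x` be the `l × s` matrix of the quotient defining
`h` at `x`; it has a right inverse, so one of its maximal minors is a unit. Morphisms to the
Grassmannian are determined by their localizations, so `h` descends to `Spec A` exactly when some
idempotent `Φ` over `A` becomes `B * M x` with `M x * B = 1` in every `𝒪_{U,x}`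
(`exists_precomp_eq_iff_exists_idempotent`).

The rest is algebra (`coeff_mul_coeff_eq_iff_exists_idempotent`). Given `Φ`, its `l × l` minors
generate the unit ideal of `A`, and each of its rows of minors is locally a multiple of the minors
of `M x`. The same holds for the `p j`, so cross products agree and the quadratic relations follow
on coefficients. Conversely, the relations make every coefficient family `p_i^α(j)` locally a
multiple of the minors of `M x`, and these coefficients generate the unit ideal. A partition of
unity built from them, combined with Cramer's rule, gives an explicit `Φ` (`exchangeProjector`).

Equalities are checked in the local rings of `U`: schematic dominance of `e` and flatness over `k`
make `A[a_0, …, a_n]` embed in their product. Unit ideals are detected because every closed point of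
`Spec A` is hit by `U`. -/

namespace GrassmannianFactorisation

/-! ### Maximal minors and Cramer's rule -/

section Minors

variable {R : Type*} [CommRing R] {s l : ℕ}

/-- The family of maximal minors of a matrix with `l` rows, indexed by sequences of columns. -/
noncomputable def columnMinors (M : Matrix (Fin l) (Fin s) R) (i : Fin l → Fin s) : R :=
  (M.submatrix id i).det

/-- A weak form of Cauchy–Binet: each column of the product is a combination of columns of `M`, and
the determinant is multilinear. -/
theorem det_mul_mem_span_columnMinors (M : Matrix (Fin l) (Fin s) R)
    (N : Matrix (Fin s) (Fin l) R) : (M * N).det ∈ Ideal.span (Set.range (columnMinors M)) := by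
  have hrow : (M * N).transpose = fun m => ∑ r, N r m • M.transpose r := by
    ext m m'
    simp [Matrix.mul_apply, mul_comm]
  rw [← Matrix.det_transpose, hrow]
  have hsum := (Matrix.detRowAlternating (R := R) (n := Fin l)).toMultilinearMap.map_sum
    (fun (m : Fin l) (r : Fin s) => N r m • M.transpose r)
  simp only [AlternatingMap.coe_multilinearMap, MultilinearMap.map_smul_univ] at hsum
  have hdet : Matrix.det (fun m => ∑ r, N r m • M.transpose r) =
      ∑ i : Fin l → Fin s, (∏ m, N (i m) m) * columnMinors M i := by
    refine hsum.trans (Finset.sum_congr rfl fun i _ => ?_)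
    rw [columnMinors, ← Matrix.det_transpose]
    rfl
  rw [hdet]
  exact Ideal.sum_mem _ fun i _ => Ideal.mul_mem_left _ _ (Ideal.subset_span ⟨i, rfl⟩)

theorem span_columnMinors_eq_top {M : Matrix (Fin l) (Fin s) R} {N : Matrix (Fin s) (Fin l) R}
    (h : M * N = 1) : Ideal.span (Set.range (columnMinors M)) = ⊤ := by
  rw [Ideal.eq_top_iff_one, ← Matrix.det_one (n := Fin l), ← h]
  exact det_mul_mem_span_columnMinors M N

theorem exists_isUnit_columnMinors [IsLocalRing R] {M : Matrix (Fin l) (Fin s) R}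
    {N : Matrix (Fin s) (Fin l) R} (h : M * N = 1) : ∃ i, IsUnit (columnMinors M i) := by
  by_contra! hM
  refine (IsLocalRing.maximalIdeal.isMaximal R).ne_top (top_le_iff.mp ?_)
  rw [← span_columnMinors_eq_top h, Ideal.span_le]
  rintro _ ⟨i, rfl⟩
  exact hM i

/-- The selection matrix whose columns are the basis vectors `e_{i₁}, …, e_{i_l}`. -/
def selectionMatrix (R : Type*) [CommRing R] (i : Fin l → Fin s) : Matrix (Fin s) (Fin l) R :=
  (1 : Matrix (Fin s) (Fin s) R).submatrix id i

theorem mul_selectionMatrix {m : Type*} (M : Matrix m (Fin s) R) (i : Fin l → Fin s) :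
    M * selectionMatrix R i = M.submatrix id i := by
  ext a b
  simp [selectionMatrix, Matrix.mul_apply, Matrix.one_apply]

/-- The matrix of the values of `q` at the sequences obtained from `i` by replacing one entry. -/
def exchangeMatrix (q : (Fin l → Fin s) → R) (i : Fin l → Fin s) : Matrix (Fin l) (Fin s) R :=
  Matrix.of fun m r => q (Function.update i m r)

/-- Cramer's rule: replacing the index at place `m` by `r` replaces a column of the selected square
block by column `r` of `M`. -/
theorem exchangeMatrix_columnMinors (M : Matrix (Fin l) (Fin s) R) (i : Fin l → Fin s) :
    exchangeMatrix (columnMinors M) i = (M.submatrix id i).adjugate * M := by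
  ext m r
  have hcol : ((M.submatrix id i).adjugate * M) m r =
      ((M.submatrix id i).adjugate.mulVec fun a => M a r) m := rfl
  rw [hcol, ← Matrix.cramer_eq_adjugate_mulVec, Matrix.cramer_apply]
  refine congrArg Matrix.det ?_
  ext a b
  rcases eq_or_ne b m with rfl | hb
  · simp
  · simp [hb]

end Minors

/-! ### Quadratic relations and idempotent matrices -/

section PluckerRelations

variable {A : Type*} [CommRing A] {s l : ℕ}

/-- The combination with coefficients `a` of the matrices exchanging the entries of the `q t`. -/
noncomputable def exchangeProjector {T : Type*} (q : T → (Fin l → Fin s) → A)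
    (a : T × (Fin l → Fin s) →₀ A) : Matrix (Fin s) (Fin s) A :=
  a.sum fun ti c => c • (selectionMatrix A ti.2 * exchangeMatrix (q ti.1) ti.2)

/-- By Cramer's rule each summand of the projector maps to a multiple of `selectionMatrix * adjugate
* M`. Multiplying the factor before `M` by `M` on the left turns block times adjugate into the
minor, so `M * B` is the image of the partition of unity `ha` times the identity. -/
theorem map_exchangeProjector {R : Type*} [CommRing R] {T : Type*}
    (q : T → (Fin l → Fin s) → A) (a : T × (Fin l → Fin s) →₀ A) (f : A →+* R)
    {M : Matrix (Fin l) (Fin s) R} (hq : ∀ t, ∃ c, ∀ i, f (q t i) = c * columnMinors M i)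
    (ha : a.sum (fun ti c => c * q ti.1 ti.2) = 1) :
    ∃ B : Matrix (Fin s) (Fin l) R,
      (exchangeProjector q a).map f = B * M ∧ M * B = 1 := by
  choose c hc using hq
  have hterm (t : T) (i : Fin l → Fin s) :
      (selectionMatrix A i * exchangeMatrix (q t) i).map f =
        c t • (selectionMatrix R i * exchangeMatrix (columnMinors M) i) := by
    rw [Matrix.map_mul, ← Matrix.mul_smul]
    congr 1
    · ext a b
      simp [selectionMatrix, Matrix.one_apply, apply_ite f]
    · ext a b
      simp [exchangeMatrix, hc]
  have hmap : (exchangeProjector q a).map f = a.sum fun ti b =>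
      (f b * c ti.1) • (selectionMatrix R ti.2 * exchangeMatrix (columnMinors M) ti.2) := by
    have hsum := map_sum f.mapMatrix (fun ti => a ti • (selectionMatrix A ti.2 *
      exchangeMatrix (q ti.1) ti.2)) a.support
    simp only [RingHom.mapMatrix_apply] at hsum
    rw [exchangeProjector, Finsupp.sum, hsum, Finsupp.sum]
    refine Finset.sum_congr rfl fun ti _ => ?_
    rw [Matrix.map_smul' _ _ _ (map_mul f), hterm, smul_smul]
  refine ⟨a.sum fun ti b => (f b * c ti.1) • (selectionMatrix R ti.2 *
    (M.submatrix id ti.2).adjugate), ?_, ?_⟩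
  · rw [hmap, Finsupp.sum, Finsupp.sum, Matrix.sum_mul]
    exact Finset.sum_congr rfl fun ti _ => by
      rw [exchangeMatrix_columnMinors, Matrix.smul_mul, Matrix.mul_assoc]
  · have hone : a.sum (fun ti b => f b * c ti.1 * columnMinors M ti.2) = 1 := by
      rw [← map_one f, ← ha, Finsupp.sum, Finsupp.sum, map_sum]
      exact Finset.sum_congr rfl fun ti _ => by rw [map_mul, hc, mul_assoc]
    rw [Finsupp.sum, Matrix.mul_sum, ← one_smul R (1 : Matrix (Fin l) (Fin l) R), ← hone,
      Finsupp.sum, Finset.sum_smul]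
    refine Finset.sum_congr rfl fun ti _ => ?_
    rw [Matrix.mul_smul, ← Matrix.mul_assoc, mul_selectionMatrix, Matrix.mul_adjugate, smul_smul,
      columnMinors]

variable {n : ℕ} {X : Type*} {O : X → Type*} [∀ x, CommRing (O x)] [∀ x, IsLocalRing (O x)]

theorem coeff_mul_coeff_eq_iff_exists_idempotent {J : Type*}
    (ev : ∀ x, MvPolynomial (Fin (n + 1)) A →+* O x)
    (hev : ∀ P, (∀ x, ev x P = 0) → P = 0)
    (hmax : ∀ m : Ideal A, m.IsMaximal → ∃ x, ∀ a,
      a ∈ m → ¬ IsUnit (ev x (MvPolynomial.C a)))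
    (M : ∀ x, Matrix (Fin l) (Fin s) (O x)) (N : ∀ x, Matrix (Fin s) (Fin l) (O x))
    (hMN : ∀ x, M x * N x = 1)
    (p : J → (Fin l → Fin s) → MvPolynomial (Fin (n + 1)) A)
    (hp : ∀ x, ∃ j₀, (∀ i, ev x (p j₀ i) = columnMinors (M x) i) ∧
      ∀ j, ∃ b, ∀ i, ev x (p j i) = b * ev x (p j₀ i)) :
    (∃ Φ : Matrix (Fin s) (Fin s) A, Φ * Φ = Φ ∧ ∀ x, ∃ B : Matrix (Fin s) (Fin l) (O x),
      Φ.map ((ev x).comp MvPolynomial.C) = B * M x ∧ M x * B = 1) ↔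
    ∀ (i₁ i₂ : Fin l → Fin s) (j₁ j₂ : J) (α₁ α₂ : Fin (n + 1) →₀ ℕ),
      (p j₁ i₁).coeff α₁ * (p j₂ i₂).coeff α₂ =
        (p j₁ i₂).coeff α₁ * (p j₂ i₁).coeff α₂ := by
  have hspan (S : Set A) (hS : ∀ x, ∃ a ∈ S, IsUnit (ev x (MvPolynomial.C a))) :
      Ideal.span S = ⊤ := by
    by_contra hne
    obtain ⟨m, hm, hle⟩ := Ideal.exists_le_maximal _ hne
    obtain ⟨x, hx⟩ := hmax m hm
    obtain ⟨a, haS, ha⟩ := hS x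
    exact hx a (hle (Ideal.subset_span haS)) ha
  constructor
  · rintro ⟨Φ, -, hΦ⟩ i₁ i₂ j₁ j₂ α₁ α₂
    -- Since `Φ` is locally `B * M x`, these minors are products of a row minor of `B` and a column
    -- minor of `M x`; both factors can be chosen to be units.
    let Q : (Fin l → Fin s) × (Fin l → Fin s) → A := fun ii => (Φ.submatrix ii.1 ii.2).det
    have hQ (x : X) : ∃ β : (Fin l → Fin s) → O x, (∃ i, IsUnit (β i)) ∧
        ∀ ii, ev x (MvPolynomial.C (Q ii)) = β ii.1 * columnMinors (M x) ii.2 := by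
      obtain ⟨B, hB, hMB⟩ := hΦ x
      refine ⟨columnMinors B.transpose, exists_isUnit_columnMinors (N := (M x).transpose) ?_,
        fun ii => ?_⟩
      · rw [← Matrix.transpose_mul, hMB, Matrix.transpose_one]
      · have hdet : ev x (MvPolynomial.C (Q ii)) =
            ((Φ.map ((ev x).comp MvPolynomial.C)).submatrix ii.1 ii.2).det :=
          RingHom.map_det ((ev x).comp MvPolynomial.C) _
        rw [hdet, hB, Matrix.submatrix_mul B (M x) ii.1 id ii.2 Function.bijective_id,
          Matrix.det_mul, columnMinors, columnMinors, ← Matrix.det_transpose]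
        rfl
    have htop : Ideal.span (Set.range Q) = ⊤ := hspan _ fun x => by
      obtain ⟨β, ⟨i, hi⟩, hβ⟩ := hQ x
      obtain ⟨i', hi'⟩ := exists_isUnit_columnMinors (hMN x)
      exact ⟨_, ⟨(i, i'), rfl⟩, by rw [hβ]; exact hi.mul hi'⟩
    have hcoeff (j : J) (i i' k : Fin l → Fin s) (α : Fin (n + 1) →₀ ℕ) :
        Q (k, i') * (p j i).coeff α = Q (k, i) * (p j i').coeff α := by
      have hpoly : MvPolynomial.C (Q (k, i')) * p j i = MvPolynomial.C (Q (k, i)) * p j i' := by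
        refine sub_eq_zero.mp (hev _ fun x => ?_)
        obtain ⟨β, -, hβ⟩ := hQ x
        obtain ⟨j₀, hj₀, hj⟩ := hp x
        obtain ⟨b, hb⟩ := hj j
        rw [map_sub, map_mul, map_mul, hβ, hβ, hb, hb, hj₀, hj₀]
        ring
      simpa using congrArg (MvPolynomial.coeff α) hpoly
    -- Each `Q (k, i)` annihilates the defect of the relation; as the `Q` generate the unit ideal,
    -- the defect vanishes.
    have hker : Ideal.span (Set.range Q) ≤ LinearMap.ker (LinearMap.toSpanSingleton A A
        ((p j₁ i₁).coeff α₁ * (p j₂ i₂).coeff α₂ -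
          (p j₁ i₂).coeff α₁ * (p j₂ i₁).coeff α₂)) := by
      rw [Ideal.span, Submodule.span_le]
      rintro _ ⟨⟨k, i⟩, rfl⟩
      simp only [SetLike.mem_coe, LinearMap.mem_ker, LinearMap.toSpanSingleton_apply, smul_eq_mul]
      linear_combination (p j₂ i₂).coeff α₂ * hcoeff j₁ i₁ i k α₁ -
        (p j₂ i₁).coeff α₂ * hcoeff j₁ i₂ i k α₁ + (p j₁ i).coeff α₁ * hcoeff j₂ i₂ i₁ k α₂
    rw [htop] at hker
    have hone := hker (Submodule.mem_top (x := (1 : A)))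
    simpa [sub_eq_zero] using hone
  · intro h
    let q : J × (Fin (n + 1) →₀ ℕ) → (Fin l → Fin s) → A := fun t i => (p t.1 i).coeff t.2
    have hq (x : X) (t) : ∃ c, ∀ i,
        ((ev x).comp MvPolynomial.C) (q t i) = c * columnMinors (M x) i := by
      obtain ⟨j₀, hj₀, -⟩ := hp x
      obtain ⟨i₀, hi₀⟩ := exists_isUnit_columnMinors (hMN x)
      obtain ⟨v, hv⟩ := hi₀.exists_left_inv
      -- The multiplier is read off at the index `i₀`, where the minor of `M x` is a unit with
      -- inverse `v`.
      refine ⟨ev x (MvPolynomial.C (q t i₀)) * v, fun i => ?_⟩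
      have hpoly : MvPolynomial.C (q t i) * p j₀ i₀ = MvPolynomial.C (q t i₀) * p j₀ i := by
        ext α
        simpa [q] using h i i₀ t.1 j₀ t.2 α
      have := congrArg (ev x) hpoly
      rw [map_mul, map_mul, hj₀, hj₀] at this
      rw [RingHom.comp_apply]
      linear_combination v * this - ev x (MvPolynomial.C (q t i)) * hv
    have htop : Ideal.span (Set.range fun ti : (J × (Fin (n + 1) →₀ ℕ)) × (Fin l → Fin s) =>
        q ti.1 ti.2) = ⊤ := hspan _ fun x => by
      obtain ⟨j₀, hj₀, -⟩ := hp x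
      obtain ⟨i₀, hi₀⟩ := exists_isUnit_columnMinors (hMN x)
      -- If all coefficients became non-units at `x`, the value of `p j₀ i₀`, a combination of them,
      -- would lie in the maximal ideal, yet it is a unit minor.
      by_contra! hnot
      rw [← hj₀] at hi₀
      have hmem : ev x (p j₀ i₀) ∈ IsLocalRing.maximalIdeal (O x) := by
        rw [← MvPolynomial.support_sum_monomial_coeff (p j₀ i₀), map_sum]
        refine Ideal.sum_mem _ fun α _ => ?_
        rw [← mul_one ((p j₀ i₀).coeff α), ← MvPolynomial.C_mul_monomial, map_mul]
        exact Ideal.mul_mem_right _ _ (hnot _ ⟨((j₀, α), i₀), rfl⟩)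
      exact hmem hi₀
    obtain ⟨a, ha⟩ := Finsupp.mem_ideal_span_range_iff_exists_finsupp.mp
      ((Ideal.eq_top_iff_one _).mp htop)
    have hΦ (x : X) := map_exchangeProjector q a _ (hq x) ha
    refine ⟨exchangeProjector q a, ?_, hΦ⟩
    -- Idempotence holds in each local ring because `(B * M) * (B * M) = B * M`, and it descends to
    -- `A` by `hev`.
    ext r r'
    refine MvPolynomial.C_injective (Fin (n + 1)) A (sub_eq_zero.mp (hev _ fun x => ?_))
    obtain ⟨B, hB, hMB⟩ := hΦ x
    have hsq : (exchangeProjector q a * exchangeProjector q a).map ((ev x).comp MvPolynomial.C) =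
        (exchangeProjector q a).map ((ev x).comp MvPolynomial.C) := by
      rw [Matrix.map_mul, hB, Matrix.mul_assoc, ← Matrix.mul_assoc (M x), hMB, Matrix.one_mul]
    rw [map_sub, sub_eq_zero]
    exact congrFun (congrFun hsq r) r'

end PluckerRelations

/-! ### Points of the Grassmannian as kernels of idempotent matrices -/

section MatrixKernel

variable (k : Type u) [Field k] (R : Type u) [CommRing R] [Algebra k R] (s : ℕ)

/-- The canonical basis of `R ⊗ k ^ s`. -/
noncomputable def standardBasis : Module.Basis (Fin s) R (R ⊗[k] (Fin s → k)) :=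
  (Pi.basisFun k (Fin s)).baseChange R

variable {s}

theorem standardBasis_apply (r : Fin s) :
    standardBasis k R s r = 1 ⊗ₜ[k] (Pi.single r 1 : Fin s → k) := by
  simp [standardBasis]

variable {R}

/-- The submodule of `R ⊗ k ^ s` of all vectors annihilated by a matrix with `s` columns. -/
noncomputable def matrixKernel {ι : Type*} (M : Matrix ι (Fin s) R) :
    Submodule R (R ⊗[k] (Fin s → k)) :=
  LinearMap.ker (M.mulVecLin ∘ₗ (standardBasis k R s).equivFun.toLinearMap)

variable {k}

theorem mem_matrixKernel {ι : Type*} {M : Matrix ι (Fin s) R} {v : R ⊗[k] (Fin s → k)} :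
    v ∈ matrixKernel k M ↔ M.mulVec ((standardBasis k R s).equivFun v) = 0 :=
  Iff.rfl

theorem mem_matrixKernel_iff_toLin {M : Matrix (Fin s) (Fin s) R} {v : R ⊗[k] (Fin s → k)} :
    v ∈ matrixKernel k M ↔
      Matrix.toLin (standardBasis k R s) (standardBasis k R s) M v = 0 := by
  rw [mem_matrixKernel,
    ← (standardBasis k R s).equivFun.map_eq_zero_iff (x := Matrix.toLin _ _ M v)]
  have : (standardBasis k R s).equivFun (Matrix.toLin (standardBasis k R s)
      (standardBasis k R s) M v) = M.mulVec ((standardBasis k R s).equivFun v) := by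
    have := LinearMap.toMatrix_mulVec_repr (standardBasis k R s) (standardBasis k R s)
      (Matrix.toLin (standardBasis k R s) (standardBasis k R s) M) v
    rw [LinearMap.toMatrix_toLin] at this
    exact this.symm
  rw [this]

theorem matrixKernel_mul_eq {l : ℕ} {M : Matrix (Fin l) (Fin s) R} {B : Matrix (Fin s) (Fin l) R}
    (hMB : M * B = 1) : matrixKernel k (B * M) = matrixKernel k M := by
  ext v
  rw [mem_matrixKernel, mem_matrixKernel, ← Matrix.mulVec_mulVec]
  refine ⟨fun h => ?_, fun h => by rw [h, Matrix.mulVec_zero]⟩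
  have := congrArg M.mulVec h
  rwa [Matrix.mulVec_mulVec, hMB, Matrix.one_mulVec, Matrix.mulVec_zero] at this

theorem mul_eq_zero_of_le_matrixKernel {ι κ : Type*} [Fintype κ] [DecidableEq κ]
    {M : Matrix ι (Fin s) R} {C : Matrix (Fin s) κ R}
    (h : ∀ v : κ → R, ∀ w, (standardBasis k R s).equivFun w = C.mulVec v →
      w ∈ matrixKernel k M) : M * C = 0 := by
  refine Matrix.ext_of_mulVec_single fun i => ?_
  rw [← Matrix.mulVec_mulVec, Matrix.zero_mulVec]
  have := h (Pi.single i 1) ((standardBasis k R s).equivFun.symm (C.mulVec (Pi.single i 1)))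
    (LinearEquiv.apply_symm_apply _ _)
  rwa [mem_matrixKernel, LinearEquiv.apply_symm_apply] at this

/-- The columns of `1 - N * M` lie in the kernel of `M`, those of `1 - Ψ` in the kernel of `Ψ`.
Equality of the kernels gives `Ψ = Ψ * N * M` and `M = M * Ψ`, so `B = Ψ * N` works. -/
theorem exists_eq_mul_of_matrixKernel_eq {l : ℕ} {M : Matrix (Fin l) (Fin s) R}
    {N : Matrix (Fin s) (Fin l) R} (hMN : M * N = 1) {Ψ : Matrix (Fin s) (Fin s) R}
    (hΨ : Ψ * Ψ = Ψ) (h : matrixKernel k Ψ = matrixKernel k M) :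
    ∃ B : Matrix (Fin s) (Fin l) R, Ψ = B * M ∧ M * B = 1 := by
  have hone : Ψ * (1 - N * M) = 0 := mul_eq_zero_of_le_matrixKernel (k := k) fun v w hw => by
    rw [h, mem_matrixKernel, hw, Matrix.mulVec_mulVec, Matrix.mul_sub, ← Matrix.mul_assoc, hMN]
    simp
  have htwo : M * (1 - Ψ) = 0 := mul_eq_zero_of_le_matrixKernel (k := k) fun v w hw => by
    rw [← h, mem_matrixKernel, hw, Matrix.mulVec_mulVec, Matrix.mul_sub, hΨ]
    simp
  have hΨN : Ψ = Ψ * N * M := by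
    rw [Matrix.mul_sub, sub_eq_zero, Matrix.mul_one, ← Matrix.mul_assoc] at hone
    exact hone
  refine ⟨Ψ * N, hΨN, ?_⟩
  rw [Matrix.mul_sub, sub_eq_zero, Matrix.mul_one] at htwo
  rw [← Matrix.mul_assoc, ← htwo, hMN]

/-- The matrix of the projection of `R ⊗ k ^ s` onto a quotient with a given basis. -/
noncomputable def quotientMatrix {l : ℕ} (W : Submodule R (R ⊗[k] (Fin s → k)))
    (F : Module.Basis (Fin l) R ((R ⊗[k] (Fin s → k)) ⧸ W)) : Matrix (Fin l) (Fin s) R :=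
  LinearMap.toMatrix (standardBasis k R s) F W.mkQ

theorem matrixKernel_quotientMatrix {l : ℕ} (W : Submodule R (R ⊗[k] (Fin s → k)))
    (F : Module.Basis (Fin l) R ((R ⊗[k] (Fin s → k)) ⧸ W)) :
    matrixKernel k (quotientMatrix W F) = W := by
  ext v
  have : (quotientMatrix W F).mulVec ((standardBasis k R s).equivFun v) =
      F.equivFun (W.mkQ v) :=
    LinearMap.toMatrix_mulVec_repr (standardBasis k R s) F W.mkQ v
  rw [mem_matrixKernel, this, LinearEquiv.map_eq_zero_iff]
  simp

theorem exists_quotientMatrix_mul_eq_one {l : ℕ} (W : Submodule R (R ⊗[k] (Fin s → k)))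
    (F : Module.Basis (Fin l) R ((R ⊗[k] (Fin s → k)) ⧸ W)) :
    ∃ N : Matrix (Fin s) (Fin l) R, quotientMatrix W F * N = 1 := by
  have : Module.Projective R ((R ⊗[k] (Fin s → k)) ⧸ W) := Module.Projective.of_basis F
  obtain ⟨g, hg⟩ := Module.projective_lifting_property W.mkQ LinearMap.id W.mkQ_surjective
  refine ⟨LinearMap.toMatrix F (standardBasis k R s) g, ?_⟩
  rw [quotientMatrix, ← LinearMap.toMatrix_comp, hg, LinearMap.toMatrix_id]

theorem columnMinors_quotientMatrix {l : ℕ} (W : Submodule R (R ⊗[k] (Fin s → k)))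
    (F : Module.Basis (Fin l) R ((R ⊗[k] (Fin s → k)) ⧸ W)) (i : Fin l → Fin s) :
    columnMinors (quotientMatrix W F) i =
      F.det fun m => W.mkQ (1 ⊗ₜ[k] (Pi.single (i m) 1 : Fin s → k)) := by
  rw [columnMinors, Module.Basis.det_apply]
  congr 1
  ext m r
  simp [quotientMatrix, LinearMap.toMatrix_apply, Module.Basis.toMatrix_apply,
    standardBasis_apply]

theorem exists_idempotent_matrixKernel_eq (W : Submodule R (R ⊗[k] (Fin s → k)))
    [Module.Projective R ((R ⊗[k] (Fin s → k)) ⧸ W)] :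
    ∃ Φ : Matrix (Fin s) (Fin s) R, Φ * Φ = Φ ∧ matrixKernel k Φ = W := by
  obtain ⟨g, hg⟩ := Module.projective_lifting_property W.mkQ LinearMap.id W.mkQ_surjective
  refine ⟨LinearMap.toMatrix (standardBasis k R s) (standardBasis k R s) (g ∘ₗ W.mkQ), ?_, ?_⟩
  · rw [← LinearMap.toMatrix_comp, LinearMap.comp_assoc, ← LinearMap.comp_assoc _ g, hg,
      LinearMap.id_comp]
  · ext v
    have hinj : Function.Injective g :=
      Function.LeftInverse.injective (g := W.mkQ) fun v => LinearMap.congr_fun hg v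
    rw [mem_matrixKernel_iff_toLin, Matrix.toLin_toMatrix, LinearMap.comp_apply,
      map_eq_zero_iff g hinj]
    simp

theorem exists_splitting_of_idempotent {Φ : Matrix (Fin s) (Fin s) R} (hΦ : Φ * Φ = Φ) :
    ∃ g : ((R ⊗[k] (Fin s → k)) ⧸ matrixKernel k Φ) →ₗ[R] (R ⊗[k] (Fin s → k)),
      g ∘ₗ (matrixKernel k Φ).mkQ = Matrix.toLin (standardBasis k R s) (standardBasis k R s) Φ ∧
      (matrixKernel k Φ).mkQ ∘ₗ g = LinearMap.id := by
  refine ⟨(matrixKernel k Φ).liftQ (Matrix.toLin (standardBasis k R s) (standardBasis k R s) Φ)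
    fun v hv => LinearMap.mem_ker.mpr (mem_matrixKernel_iff_toLin.mp hv),
    Submodule.liftQ_mkQ _ _ _, ?_⟩
  refine Submodule.linearMap_qext _ (LinearMap.ext fun v => ?_)
  rw [LinearMap.comp_assoc, Submodule.liftQ_mkQ, LinearMap.id_comp, LinearMap.comp_apply,
    ← sub_eq_zero, ← map_sub, Submodule.mkQ_apply, Submodule.Quotient.mk_eq_zero,
    mem_matrixKernel_iff_toLin, map_sub, ← LinearMap.comp_apply, ← Matrix.toLin_mul, hΦ, sub_self]

theorem projective_quotient_matrixKernel {Φ : Matrix (Fin s) (Fin s) R} (hΦ : Φ * Φ = Φ) :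
    Module.Projective R ((R ⊗[k] (Fin s → k)) ⧸ matrixKernel k Φ) := by
  obtain ⟨g, -, hg⟩ := exists_splitting_of_idempotent (k := k) hΦ
  exact Module.Projective.of_split g _ hg

variable {A : Type u} [CommRing A] [Algebra k A]

/-- The quotient by the kernel embeds through a split injection `g`, which stays injective after
base change; composing with it turns the projection into the base change of `Φ`. -/
theorem ker_baseChangeMkQ_matrixKernel [Algebra A R] [IsScalarTower k A R]
    {Φ : Matrix (Fin s) (Fin s) A} (hΦ : Φ * Φ = Φ) :
    LinearMap.ker (Module.Grassmannian.baseChangeMkQ R (matrixKernel k Φ)) =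
      matrixKernel k (Φ.map (algebraMap A R)) := by
  obtain ⟨g, hg, hg'⟩ := exists_splitting_of_idempotent (k := k) hΦ
  have hinj : Function.Injective (g.baseChange R) :=
    Function.LeftInverse.injective (g := (matrixKernel k Φ).mkQ.baseChange R) fun v => by
      rw [← LinearMap.comp_apply, ← LinearMap.baseChange_comp, hg', LinearMap.baseChange_id,
        LinearMap.id_apply]
  have hcomp : (TensorProduct.AlgebraTensorModule.cancelBaseChange k A R R
      (Fin s → k)).toLinearMap ∘ₗ g.baseChange R ∘ₗ
        Module.Grassmannian.baseChangeMkQ R (matrixKernel k Φ) =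
      Matrix.toLin (standardBasis k R s) (standardBasis k R s) (Φ.map (algebraMap A R)) := by
    refine (standardBasis k R s).ext fun r => ?_
    have hgr := LinearMap.congr_fun hg (standardBasis k A s r)
    rw [Matrix.toLin_self, LinearMap.comp_apply, standardBasis_apply] at hgr
    rw [Matrix.toLin_self, standardBasis_apply]
    simp only [Module.Grassmannian.baseChangeMkQ, LinearMap.comp_apply, LinearEquiv.coe_coe,
      TensorProduct.AlgebraTensorModule.cancelBaseChange_symm_tmul, LinearMap.baseChange_tmul,
      hgr, TensorProduct.tmul_sum, map_sum]
    refine Finset.sum_congr rfl fun r' _ => ?_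
    rw [standardBasis_apply, standardBasis_apply, TensorProduct.smul_tmul',
      TensorProduct.AlgebraTensorModule.cancelBaseChange_tmul]
    simp [TensorProduct.smul_tmul', Algebra.smul_def]
  ext v
  rw [mem_matrixKernel_iff_toLin, ← hcomp, LinearMap.comp_apply, LinearMap.comp_apply,
    LinearEquiv.coe_coe, LinearEquiv.map_eq_zero_iff, map_eq_zero_iff _ hinj, LinearMap.mem_ker]

theorem map_toSubmodule_of_idempotent {l : ℕ} (f : A →ₐ[k] R)
    (W : Module.Grassmannian A (A ⊗[k] (Fin s → k)) l) {Φ : Matrix (Fin s) (Fin s) A}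
    (hΦ : Φ * Φ = Φ) (hW : W.toSubmodule = matrixKernel k Φ) :
    (Module.Grassmannian.map f W).toSubmodule = matrixKernel k (Φ.map f) := by
  let _ : Algebra A R := f.toAlgebra
  have : IsScalarTower k A R := IsScalarTower.of_algebraMap_eq' f.comp_algebraMap.symm
  rw [Module.Grassmannian.map_toSubmodule, hW]
  exact ker_baseChangeMkQ_matrixKernel hΦ

theorem rankAtStalk_quotient_matrixKernel {l : ℕ} (f : A →ₐ[k] R)
    {Φ : Matrix (Fin s) (Fin s) A} (hΦ : Φ * Φ = Φ)
    (W : Module.Grassmannian R (R ⊗[k] (Fin s → k)) l)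
    (hW : W.toSubmodule = matrixKernel k (Φ.map f)) (c : PrimeSpectrum R) :
    Module.rankAtStalk (R := A) ((A ⊗[k] (Fin s → k)) ⧸ matrixKernel k Φ)
      (PrimeSpectrum.comap f.toRingHom c) = l := by
  let _ : Algebra A R := f.toAlgebra
  have : IsScalarTower k A R := IsScalarTower.of_algebraMap_eq' f.comp_algebraMap.symm
  have := projective_quotient_matrixKernel (k := k) hΦ
  have hker : W.toSubmodule =
      LinearMap.ker (Module.Grassmannian.baseChangeMkQ R (matrixKernel k Φ)) :=
    hW.trans (ker_baseChangeMkQ_matrixKernel hΦ).symm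
  rw [← W.rankAtStalk_eq c, Module.rankAtStalk_eq_of_equiv (Submodule.quotEquivOfEq _ _ hker),
    Module.rankAtStalk_eq_of_equiv
      (Module.Grassmannian.baseChangeMkQEquiv (B := R) (matrixKernel k Φ)),
    Module.rankAtStalk_baseChange]
  rfl

/-- The kernel of an idempotent matrix, as a point of the Grassmannian, when its base change along
a homomorphism hitting each closed point is a point of the Grassmannian. -/
theorem exists_grassmannian_of_idempotent {l : ℕ} {Φ : Matrix (Fin s) (Fin s) A}
    (hΦ : Φ * Φ = Φ)
    (hmax : ∀ c : PrimeSpectrum A, c.asIdeal.IsMaximal → ∃ (R : CommAlgCat.{u} k) (f : A →ₐ[k] R)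
      (y : PrimeSpectrum R) (W : Module.Grassmannian R (R ⊗[k] (Fin s → k)) l),
      W.toSubmodule = matrixKernel k (Φ.map f) ∧ PrimeSpectrum.comap f.toRingHom y = c) :
    ∃ W : Module.Grassmannian A (A ⊗[k] (Fin s → k)) l, W.toSubmodule = matrixKernel k Φ := by
  have hproj := projective_quotient_matrixKernel (k := k) hΦ
  refine ⟨⟨matrixKernel k Φ, inferInstance, hproj, fun q => ?_⟩, rfl⟩
  obtain ⟨m, hm, hle⟩ := Ideal.exists_le_maximal q.asIdeal q.isPrime.ne_top
  obtain ⟨R, f, y, W, hW, hy⟩ := hmax ⟨m, hm.isPrime⟩ hm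
  -- The rank of a finite flat module is unchanged under specialization, so maximal ideals suffice.
  rw [Module.rankAtStalk_eq_of_le_of_finite_of_flat _ (show q ≤ ⟨m, hm.isPrime⟩ from hle), ← hy]
  exact rankAtStalk_quotient_matrixKernel f hΦ W hW y

theorem eq_of_map_localization_eq {l : ℕ}
    (W W' : Module.Grassmannian A (A ⊗[k] (Fin s → k)) l)
    (h : ∀ (m : Ideal A) [m.IsMaximal],
      Module.Grassmannian.map (Algebra.algHom k A (Localization.AtPrime m)) W =
      Module.Grassmannian.map (Algebra.algHom k A (Localization.AtPrime m)) W') : W = W' := by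
  obtain ⟨Φ, hΦ, hW⟩ := exists_idempotent_matrixKernel_eq W.toSubmodule
  obtain ⟨Φ', hΦ', hW'⟩ := exists_idempotent_matrixKernel_eq W'.toSubmodule
  have hle {Ψ Ψ' : Matrix (Fin s) (Fin s) A} (hΨ : Ψ * Ψ = Ψ)
      (hker : ∀ (m : Ideal A) [m.IsMaximal],
        matrixKernel k (Ψ.map (Algebra.algHom k A (Localization.AtPrime m))) =
        matrixKernel k (Ψ'.map (Algebra.algHom k A (Localization.AtPrime m)))) :
      matrixKernel k Ψ ≤ matrixKernel k Ψ' := by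
    -- The image of `1 - Ψ` is the kernel of `Ψ`, so the inclusion of kernels becomes a matrix
    -- identity, which is local at maximal ideals.
    have hzero : Ψ' * (1 - Ψ) = 0 := by
      ext r r'
      refine Module.eq_of_localization_maximal (fun m _ => Localization.AtPrime m)
        (fun m _ => Algebra.linearMap A (Localization.AtPrime m)) _ _ fun m _ => ?_
      let f := Algebra.algHom k A (Localization.AtPrime m)
      have hmap : Ψ'.map f * (1 - Ψ).map f = 0 :=
        mul_eq_zero_of_le_matrixKernel (k := k) fun v w hw => by
          rw [← hker, mem_matrixKernel, hw, Matrix.mulVec_mulVec, ← Matrix.map_mul,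
            Matrix.mul_sub, hΨ]
          simp
      rw [← Matrix.map_mul] at hmap
      exact (congrFun (congrFun hmap r) r').trans (map_zero (Algebra.linearMap A _)).symm
    intro v hv
    rw [mem_matrixKernel] at hv ⊢
    rw [Matrix.mul_sub, sub_eq_zero, Matrix.mul_one] at hzero
    rw [hzero, ← Matrix.mulVec_mulVec, hv, Matrix.mulVec_zero]
  have hker (m : Ideal A) [m.IsMaximal] :
      matrixKernel k (Φ.map (Algebra.algHom k A (Localization.AtPrime m))) =
        matrixKernel k (Φ'.map (Algebra.algHom k A (Localization.AtPrime m))) := by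
    rw [← map_toSubmodule_of_idempotent _ W hΦ hW.symm,
      ← map_toSubmodule_of_idempotent _ W' hΦ' hW'.symm, h]
  refine Module.Grassmannian.ext ?_
  rw [← hW, ← hW']
  exact le_antisymm (hle hΦ fun m _ => hker m) (hle hΦ' fun m _ => (hker m).symm)

end MatrixKernel

/-! ### Morphisms to the Grassmannian and their localizations -/

section Points

variable {k : Type u} [Field k]

/-- The homomorphism of algebras underlying a morphism of affine `k`-schemes. -/
noncomputable def algHomOfSpecHom {A R : CommAlgCat.{u} k}
    (φ : (algSpec (CommRingCat.of k)).obj (op R) ⟶ (algSpec (CommRingCat.of k)).obj (op A)) :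
    A ⟶ R :=
  ((algSpec.fullyFaithful (R := CommRingCat.of k)).preimage φ).unop

theorem algSpec_map_algHomOfSpecHom {A R : CommAlgCat.{u} k}
    (φ : (algSpec (CommRingCat.of k)).obj (op R) ⟶ (algSpec (CommRingCat.of k)).obj (op A)) :
    (algSpec (CommRingCat.of k)).map (algHomOfSpecHom φ).op = φ :=
  (algSpec.fullyFaithful (R := CommRingCat.of k)).map_preimage φ

theorem algHomOfSpecHom_comp {A R S : CommAlgCat.{u} k} (f : R ⟶ S)
    (φ : (algSpec (CommRingCat.of k)).obj (op R) ⟶ (algSpec (CommRingCat.of k)).obj (op A)) :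
    algHomOfSpecHom ((algSpec (CommRingCat.of k)).map f.op ≫ φ) = algHomOfSpecHom φ ≫ f := by
  refine Quiver.Hom.op_inj ((algSpec.fullyFaithful (R := CommRingCat.of k)).map_injective ?_)
  refine (algSpec_map_algHomOfSpecHom _).trans ?_
  rw [op_comp]
  refine Eq.symm (((algSpec (CommRingCat.of k)).map_comp _ _).trans ?_)
  exact congrArg _ (algSpec_map_algHomOfSpecHom φ)

theorem Spec_map_algHomOfSpecHom {A R : CommAlgCat.{u} k}
    (φ : (algSpec (CommRingCat.of k)).obj (op R) ⟶ (algSpec (CommRingCat.of k)).obj (op A)) :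
    Spec.map (CommRingCat.ofHom (algHomOfSpecHom φ).hom.toRingHom) = φ.left :=
  congrArg CommaMorphism.left (algSpec_map_algHomOfSpecHom φ)

variable {s l : ℕ}

/-- The morphism `Spec A ⟶ 𝔾` corresponding to an `A`-point of the Grassmannian. -/
noncomputable def GrassmannianMorphism.ofPoint {A : CommAlgCat.{u} k}
    (W : (grassmannian k s l).obj A) :
    GrassmannianMorphism ((algSpec (CommRingCat.of k)).obj (op A)) s l where
  app R := ↾fun φ => (grassmannian k s l).map (algHomOfSpecHom φ) W
  naturality R S f := by
    refine ConcreteCategory.hom_ext _ _ fun φ => ?_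
    change (grassmannian k s l).map
        (algHomOfSpecHom ((algSpec (CommRingCat.of k)).map f.op ≫ φ)) W =
      (grassmannian k s l).map f ((grassmannian k s l).map (algHomOfSpecHom φ) W)
    rw [algHomOfSpecHom_comp, Functor.map_comp]
    rfl

theorem GrassmannianMorphism.app_comp {X : Over (Spec (CommRingCat.of k))}
    (h : GrassmannianMorphism X s l) {R S : CommAlgCat.{u} k} (f : R ⟶ S)
    (y : (algSpec (CommRingCat.of k)).obj (op R) ⟶ X) :
    h.app S ((algSpec (CommRingCat.of k)).map f.op ≫ y) =
      (grassmannian k s l).map f (h.app R y) :=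
  ConcreteCategory.congr_hom (h.naturality f) y

/-- The Yoneda lemma: a morphism from `Spec A` is determined by its value at the identity. -/
theorem GrassmannianMorphism.app_eq_map_algHomOfSpecHom {A R : CommAlgCat.{u} k}
    (g : GrassmannianMorphism ((algSpec (CommRingCat.of k)).obj (op A)) s l)
    (φ : (algSpec (CommRingCat.of k)).obj (op R) ⟶ (algSpec (CommRingCat.of k)).obj (op A)) :
    g.app R φ = (grassmannian k s l).map (algHomOfSpecHom φ) (g.app A (𝟙 _)) := by
  refine Eq.trans ?_ (g.app_comp (algHomOfSpecHom φ) (𝟙 _))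
  refine congrArg (g.app R) ?_
  exact ((Category.comp_id _).trans (algSpec_map_algHomOfSpecHom φ)).symm

/-- The point `x` is the image of the closed point: every open neighbourhood of `x` pulls back to
all of `Spec R`. -/
theorem exists_eq_comp_stalkPoint {X : Over (Spec (CommRingCat.of k))} {R : CommAlgCat.{u} k}
    [IsLocalRing R] (y : (algSpec (CommRingCat.of k)).obj (op R) ⟶ X) :
    ∃ (x : X.left) (f : stalkAlgebra X x ⟶ R),
      y = (algSpec (CommRingCat.of k)).map f.op ≫ stalkPoint X x := by
  have : IsLocalRing (CommRingCat.of R) := ‹IsLocalRing R›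
  let y' : Spec (CommRingCat.of R) ⟶ X.left := y.left
  let x : X.left := y' (IsLocalRing.closedPoint R)
  let z : (algSpec (CommRingCat.of k)).obj (op R) ⟶
      (algSpec (CommRingCat.of k)).obj (op (stalkAlgebra X x)) :=
    Over.homMk (Spec.map (Scheme.stalkClosedPointTo y')) (by
      have hw := congrArg (· ≫ X.hom) (Scheme.Spec_stalkClosedPointTo_fromSpecStalk y')
      refine Eq.trans ?_ (hw.trans (Over.w y))
      refine Eq.trans ?_ (Category.assoc _ _ _).symm
      exact congrArg (Spec.map (Scheme.stalkClosedPointTo y') ≫ ·)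
        (Over.w (stalkPoint X x)).symm)
  refine ⟨x, algHomOfSpecHom z, Eq.trans ?_
    (congrArg (· ≫ stalkPoint X x) (algSpec_map_algHomOfSpecHom z)).symm⟩
  exact Over.OverMorphism.ext (Scheme.Spec_stalkClosedPointTo_fromSpecStalk y').symm

/-- Morphisms to a Grassmannian are determined by their localizations at the points. -/
theorem GrassmannianMorphism.ext_of_localize {X : Over (Spec (CommRingCat.of k))}
    {h h' : GrassmannianMorphism X s l} (hx : ∀ x, h.localize x = h'.localize x) : h = h' := by
  refine NatTrans.ext (funext fun R => ConcreteCategory.hom_ext _ _ fun y => ?_)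
  refine eq_of_map_localization_eq _ _ fun m _ => ?_
  let S : CommAlgCat.{u} k := CommAlgCat.of k (Localization.AtPrime m)
  let f : R ⟶ S := CommAlgCat.ofHom (Algebra.algHom k R (Localization.AtPrime m))
  have : IsLocalRing S := inferInstanceAs (IsLocalRing (Localization.AtPrime m))
  obtain ⟨x, g, hg⟩ := exists_eq_comp_stalkPoint ((algSpec (CommRingCat.of k)).map f.op ≫ y)
  have key : h.app S ((algSpec (CommRingCat.of k)).map f.op ≫ y) =
      h'.app S ((algSpec (CommRingCat.of k)).map f.op ≫ y) := by
    rw [hg, h.app_comp, h'.app_comp]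
    exact congrArg _ (hx x)
  rw [h.app_comp, h'.app_comp] at key
  exact key

/-- The homomorphism `A → 𝒪_{X,x}` induced by a `k`-morphism `X ⟶ Spec A`. -/
noncomputable def toStalk {X : Over (Spec (CommRingCat.of k))} {A : CommAlgCat.{u} k}
    (q : X ⟶ (algSpec (CommRingCat.of k)).obj (op A)) (x : X.left) : A ⟶ stalkAlgebra X x :=
  algHomOfSpecHom (stalkPoint X x ≫ q)

theorem Spec_map_toStalk {X : Over (Spec (CommRingCat.of k))} {A : CommAlgCat.{u} k}
    (q : X ⟶ (algSpec (CommRingCat.of k)).obj (op A)) (x : X.left) :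
    Spec.map (CommRingCat.ofHom (toStalk q x).hom.toRingHom) = X.left.fromSpecStalk x ≫ q.left :=
  Spec_map_algHomOfSpecHom _

theorem localize_precomp {X : Over (Spec (CommRingCat.of k))} {A : CommAlgCat.{u} k}
    (g : GrassmannianMorphism ((algSpec (CommRingCat.of k)).obj (op A)) s l)
    (q : X ⟶ (algSpec (CommRingCat.of k)).obj (op A)) (x : X.left) :
    (g.precomp q).localize x =
      Module.Grassmannian.map (toStalk q x).hom (g.app A (𝟙 _)) :=
  g.app_eq_map_algHomOfSpecHom _

instance isLocalRing_stalkAlgebra (X : Over (Spec (CommRingCat.of k))) (x : X.left) :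
    IsLocalRing (stalkAlgebra X x) :=
  inferInstanceAs (IsLocalRing (X.left.presheaf.stalk x))

theorem comap_toStalk_closedPoint {X : Over (Spec (CommRingCat.of k))} {A : CommAlgCat.{u} k}
    (q : X ⟶ (algSpec (CommRingCat.of k)).obj (op A)) (x : X.left) :
    PrimeSpectrum.comap (toStalk q x).hom.toRingHom
      (IsLocalRing.closedPoint (stalkAlgebra X x)) = q.left x := by
  have h := congrArg (fun φ => φ (IsLocalRing.closedPoint (X.left.presheaf.stalk x)))
    (Spec_map_toStalk q x)
  refine Eq.trans h ((Scheme.Hom.comp_apply _ _ _).trans ?_)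
  exact congrArg q.left Scheme.fromSpecStalk_closedPoint

theorem toStalk_apply {X : Over (Spec (CommRingCat.of k))} {A : CommAlgCat.{u} k}
    (q : X ⟶ (algSpec (CommRingCat.of k)).obj (op A)) (x : X.left) (a : A) :
    (toStalk q x).hom a =
      germAt X x (q.left.appTop.hom ((Scheme.ΓSpecIso (CommRingCat.of A)).inv.hom a)) := by
  have h : CommRingCat.ofHom (toStalk q x).hom.toRingHom =
      (Scheme.ΓSpecIso (CommRingCat.of A)).inv ≫ q.left.appTop ≫
        X.left.presheaf.germ ⊤ x trivial := by
    let q' : X.left ⟶ Spec (CommRingCat.of A) := q.left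
    let f' : CommRingCat.of A ⟶ X.left.presheaf.stalk x :=
      CommRingCat.ofHom (toStalk q x).hom.toRingHom
    have htop : Scheme.Hom.appTop (Spec.map f') = (X.left.fromSpecStalk x ≫ q').appTop :=
      congrArg Scheme.Hom.appTop (Spec_map_toStalk q x)
    rw [Scheme.Hom.comp_appTop, Scheme.fromSpecStalk_appTop] at htop
    change f' = (Scheme.ΓSpecIso (CommRingCat.of A)).inv ≫ q'.appTop ≫ _
    rw [← cancel_mono (Scheme.ΓSpecIso (X.left.presheaf.stalk x)).inv,
      Scheme.ΓSpecIso_inv_naturality, htop]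
    simp
  exact congrArg (fun φ => φ.hom a) h

/-- Reduces descent to linear algebra: the matrix condition at `x` says that `Φ` and the quotient
matrix have the same kernel, that is, that the kernel of `Φ` induces `h` at `x`. The rank of that
kernel's quotient is then checked at points of `X` above closed points. -/
theorem exists_precomp_eq_iff_exists_idempotent {X : Over (Spec (CommRingCat.of k))}
    {A : CommAlgCat.{u} k} (q : X ⟶ (algSpec (CommRingCat.of k)).obj (op A))
    (hq : ∀ c : PrimeSpectrum A, IsClosed {c} → ∃ x : X.left, q.left x = c)
    (h : GrassmannianMorphism X s l)
    (F : ∀ x, Module.Basis (Fin l) (stalkAlgebra X x)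
      ((stalkAlgebra X x ⊗[k] (Fin s → k)) ⧸ (h.localize x).toSubmodule)) :
    (∃ g : GrassmannianMorphism ((algSpec (CommRingCat.of k)).obj (op A)) s l,
      h = g.precomp q) ↔
    ∃ Φ : Matrix (Fin s) (Fin s) A, Φ * Φ = Φ ∧
      ∀ x, ∃ B : Matrix (Fin s) (Fin l) (stalkAlgebra X x),
        Φ.map (toStalk q x).hom = B * quotientMatrix (h.localize x).toSubmodule (F x) ∧
        quotientMatrix (h.localize x).toSubmodule (F x) * B = 1 := by
  constructor
  · rintro ⟨g, hg⟩
    let W : Module.Grassmannian A (A ⊗[k] (Fin s → k)) l := g.app A (𝟙 _)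
    obtain ⟨Φ, hΦ, hW⟩ := exists_idempotent_matrixKernel_eq W.toSubmodule
    refine ⟨Φ, hΦ, fun x => ?_⟩
    obtain ⟨N, hN⟩ := exists_quotientMatrix_mul_eq_one _ (F x)
    have hloc : h.localize x = Module.Grassmannian.map (toStalk q x).hom W := by
      rw [← localize_precomp, hg]
    refine exists_eq_mul_of_matrixKernel_eq (k := k) hN ?_ ?_
    · rw [← Matrix.map_mul, hΦ]
    · rw [matrixKernel_quotientMatrix, hloc, map_toSubmodule_of_idempotent _ W hΦ hW.symm]
  · rintro ⟨Φ, hΦ, hB⟩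
    have hloc (x : X.left) :
        (h.localize x).toSubmodule = matrixKernel k (Φ.map (toStalk q x).hom) := by
      obtain ⟨B, hB, hMB⟩ := hB x
      rw [hB, matrixKernel_mul_eq hMB, matrixKernel_quotientMatrix]
    obtain ⟨W, hW⟩ : ∃ W : Module.Grassmannian A (A ⊗[k] (Fin s → k)) l,
        W.toSubmodule = matrixKernel k Φ := by
      refine exists_grassmannian_of_idempotent hΦ fun c hc => ?_
      obtain ⟨x, hx⟩ := hq c ((PrimeSpectrum.isClosed_singleton_iff_isMaximal c).mpr hc)
      exact ⟨stalkAlgebra X x, (toStalk q x).hom, IsLocalRing.closedPoint _, h.localize x,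
        hloc x, (comap_toStalk_closedPoint q x).trans hx⟩
    refine ⟨.ofPoint W, GrassmannianMorphism.ext_of_localize fun x => ?_⟩
    refine Module.Grassmannian.ext ?_
    rw [hloc]
    exact (map_toSubmodule_of_idempotent (toStalk q x).hom W hΦ hW).symm

end Points

/-! ### Detecting polynomials over `A` in the local rings of `U` -/

section Injectivity

theorem appTop_injective_of_isAffine {X Y : Scheme.{u}} [IsAffine Y] (f : X ⟶ Y)
    [IsSchemeTheoreticallyDominant f] : Function.Injective f.appTop := by
  have h := f.ker_eq_bot
  rw [Scheme.ker_of_isAffine] at h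
  have htop := congrArg (fun I : Y.IdealSheafData => I.ideal ⟨⊤, isAffineOpen_top Y⟩) h
  simp only [Scheme.IdealSheafData.ofIdealTop_ideal] at htop
  rw [RingHom.injective_iff_ker_eq_bot]
  simpa using htop

/-- Tensoring the injection of `k[a_0, …, a_n]` into its fraction field with `A`, which is flat over
the field `k`, preserves injectivity. -/
theorem ofPolynomial_injective (k : Type u) [Field k] (A : Type u) [CommRing A] [Algebra k A]
    (n : ℕ) : Function.Injective (ofPolynomial k A n) := by
  have hfactor : ofPolynomial k A n = (Algebra.TensorProduct.map (AlgHom.id A A)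
      (IsScalarTower.toAlgHom k (MvPolynomial (Fin (n + 1)) k) (RatFun k n))).comp
        (MvPolynomial.algebraTensorAlgEquiv k A).symm.toAlgHom := by
    ext m
    simp [ofPolynomial]
  rw [hfactor]
  have hmap : Function.Injective (Algebra.TensorProduct.map (AlgHom.id A A)
      (IsScalarTower.toAlgHom k (MvPolynomial (Fin (n + 1)) k) (RatFun k n))) :=
    Module.Flat.lTensor_preserves_injective_linearMap (M := A)
      (IsScalarTower.toAlgHom k (MvPolynomial (Fin (n + 1)) k) (RatFun k n)).toLinearMap
      (IsFractionRing.injective _ _)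
  exact hmap.comp (MvPolynomial.algebraTensorAlgEquiv k A).symm.injective

variable {k : Type u} [Field k] {A : Type u} [CommRing A] [Algebra k A] {n : ℕ}
  {U : Over (Spec (CommRingCat.of k))} (e : U ⟶ specOver k (GenericExtension k A n))

/-- The value of a polynomial with coefficients in `A` in the local ring of `U` at a point. -/
noncomputable def polynomialGerm (x : U.left) :
    MvPolynomial (Fin (n + 1)) A →+* stalkAlgebra U x :=
  (toStalk e x).hom.toRingHom.comp (ofPolynomial k A n).toRingHom

theorem polynomialGerm_apply (x : U.left) (P : MvPolynomial (Fin (n + 1)) A) :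
    polynomialGerm e x P = germAt U x (pullbackFunction e (ofPolynomial k A n P)) :=
  toStalk_apply e x _

theorem polynomialGerm_comp_C (x : U.left) :
    (polynomialGerm e x).comp MvPolynomial.C =
      (toStalk (A := CommAlgCat.of k A) (e ≫ firstProjection k A n) x).hom.toRingHom := by
  have hcomp : toStalk (A := CommAlgCat.of k A) (e ≫ firstProjection k A n) x =
      CommAlgCat.ofHom (Algebra.TensorProduct.includeLeft : A →ₐ[k] GenericExtension k A n) ≫
        toStalk e x := by
    refine Quiver.Hom.op_inj ((algSpec.fullyFaithful (R := CommRingCat.of k)).map_injective ?_)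
    refine (algSpec_map_algHomOfSpecHom _).trans (Eq.symm ?_)
    refine ((algSpec (CommRingCat.of k)).map_comp _ _).trans ?_
    refine (congrArg (· ≫ firstProjection k A n) (algSpec_map_algHomOfSpecHom _)).trans ?_
    exact Category.assoc _ _ _
  rw [hcomp]
  ext a
  exact congrArg (toStalk e x).hom (by simp [ofPolynomial]; rfl)

theorem eq_zero_of_polynomialGerm_eq_zero [IsSchemeTheoreticallyDominant e.left]
    {P : MvPolynomial (Fin (n + 1)) A} (hP : ∀ x, polynomialGerm e x P = 0) : P = 0 := by
  refine (map_eq_zero_iff _ (ofPolynomial_injective k A n)).mp ?_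
  have hzero : pullbackFunction e (ofPolynomial k A n P) = 0 := by
    refine TopCat.Presheaf.section_ext U.left.sheaf ⊤ _ _ fun x hx => ?_
    have := hP x
    rw [polynomialGerm_apply] at this
    exact this.trans (map_zero (U.left.presheaf.germ ⊤ x trivial).hom).symm
  have : IsAffine (specOver k (GenericExtension k A n)).left :=
    inferInstanceAs (IsAffine (Spec (CommRingCat.of (GenericExtension k A n))))
  refine (map_eq_zero_iff (Scheme.ΓSpecIso (CommRingCat.of (GenericExtension k A n))).inv.hom
    (ConcreteCategory.bijective_of_isIso
      (Scheme.ΓSpecIso (CommRingCat.of (GenericExtension k A n))).inv).1).mp ?_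
  exact (map_eq_zero_iff e.left.appTop.hom (appTop_injective_of_isAffine e.left)).mp hzero

end Injectivity

end GrassmannianFactorisation

theorem mainTheorem7 {k : Type u} [Field k] {A : Type u} [CommRing A] [Algebra k A]
    {n s l : ℕ}
    {U : Over (Spec (CommRingCat.of k))}
    (e : U ⟶ GrassmannianFactorisation.specOver k
      (GrassmannianFactorisation.GenericExtension k A n))
    (he : IsOpenImmersion e.left)
    (he_dominant : IsSchemeTheoreticallyDominant e.left)
    (hpr_dominant : IsSchemeTheoreticallyDominant
      (e ≫ GrassmannianFactorisation.firstProjection k A n).left)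
    (hpr_closed : ∀ c : (GrassmannianFactorisation.specOver k A).left, IsClosed {c} →
      ∃ x : U.left, (e ≫ GrassmannianFactorisation.firstProjection k A n).left x = c)
    (h : GrassmannianFactorisation.GrassmannianMorphism U s l)
    {J : Type*} (p : J → (Fin l → Fin s) → MvPolynomial (Fin (n + 1)) A)
    (hp : GrassmannianFactorisation.IsSuperabundant h fun j i =>
      GrassmannianFactorisation.pullbackFunction e
        (GrassmannianFactorisation.ofPolynomial k A n (p j i))) :
    (∃ g : GrassmannianFactorisation.GrassmannianMorphism
        (GrassmannianFactorisation.specOver k A) s l,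
      h = g.precomp (e ≫ GrassmannianFactorisation.firstProjection k A n)) ↔
    ∀ (i₁ i₂ : Fin l → Fin s) (j₁ j₂ : J) (α₁ α₂ : Fin (n + 1) →₀ ℕ),
      (p j₁ i₁).coeff α₁ * (p j₂ i₂).coeff α₂ =
        (p j₁ i₂).coeff α₁ * (p j₂ i₁).coeff α₂ := by
  open GrassmannianFactorisation in
  choose j₀ hj₀ hb using hp
  choose F hF using hj₀
  choose N hN using fun x => exists_quotientMatrix_mul_eq_one _ (F x)
  refine Iff.trans (exists_precomp_eq_iff_exists_idempotent (A := CommAlgCat.of k A)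
    (e ≫ firstProjection k A n) hpr_closed h F) ?_
  have hmax (m : Ideal A) (hm : m.IsMaximal) : ∃ x : U.left, ∀ a, a ∈ m →
      ¬ IsUnit (polynomialGerm e x (MvPolynomial.C a)) := by
    obtain ⟨x, hx⟩ := hpr_closed ⟨m, hm.isPrime⟩
      ((PrimeSpectrum.isClosed_singleton_iff_isMaximal _).mpr hm)
    refine ⟨x, fun a ha hunit => ?_⟩
    -- The maximal ideal of the local ring at `x` contracts to `m`, so elements of `m` cannot become
    -- units there.
    have hcomap := (comap_toStalk_closedPoint (A := CommAlgCat.of k A)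
      (e ≫ firstProjection k A n) x).trans hx
    have hmem : a ∈ (PrimeSpectrum.comap (toStalk (A := CommAlgCat.of k A)
        (e ≫ firstProjection k A n) x).hom.toRingHom
          (IsLocalRing.closedPoint (stalkAlgebra U x))).asIdeal := by
      rw [hcomap]
      exact ha
    rw [← polynomialGerm_comp_C] at hmem
    exact hmem hunit
  have key := coeff_mul_coeff_eq_iff_exists_idempotent (fun x => polynomialGerm e x)
    (fun P hP => eq_zero_of_polynomialGerm_eq_zero e hP) hmax
    (fun x => quotientMatrix (h.localize x).toSubmodule (F x)) N hN p fun x =>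
      ⟨j₀ x, fun i => by
        rw [polynomialGerm_apply, columnMinors_quotientMatrix]; exact hF x i, fun j => by
        simpa only [polynomialGerm_apply] using hb x j⟩
  simp only [polynomialGerm_comp_C] at key
  exact key
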